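/- Let $k\ge 1$ and $\mathcal X=\mathbb C^{2^k}$. A cut-and-choose protocol with general tests for verifiable delegated quantum computation consists of a probability distribution $\Omega$ on $\mathbb N$, for each $n$ a probability distribution $\omega_n$ on $\{1,\dots,n+1\}$, and for all $n$ and $\ell\in\{1,\dots,n+1\}$: a number $W$ of $k$-qubit registers, a finite-dimensional space $\mathcal Y$ that the client keeps, a density operator $\chi$ on $\mathcal X^{\otimes W}\otimes\mathcal Y$, an $n$-comb from $\mathcal X^{\otimes W}$ to $\mathcal X^{\otimes W}$ with $n$ holes on $\mathcal X$ (that is, $n+1$ channels that are connected by the holes and by finite-dimensional memories), unitaries $T_1,\dots,T_n$ on $\mathcal X$, and a measurement operator $0\le\mu\le\mathbb 1$ on $\mathcal X^{\otimes W}\otimes\mathcal Y$. On an input state $\psi$ on $\mathcal X$ and a unitary $U$ on $\mathcal X$, the client samples $n$ from $\Omega$ and $\ell$ from $\omega_n$ and prepares $\chi$. In round $\ell$ of the $n+1$ rounds she delegates $U$ on $\psi$ to the server. In the other $n$ rounds she runs the comb and delegates $T_1,\dots,T_n$, in this order, in its holes. She then measures $\{\mu,\mathbb 1-\mu\}$ on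 the output of the comb and $\mathcal Y$; on the outcome $\mu$ she outputs the result of round $\ell$, and otherwise the symbol $|\bot\rangle\langle\bot|$, which is orthogonal to $\mathcal X$. A server may hold a memory and, in each round, apply a channel to the delegated register and its memory before and after the delegated unitary; an honest server does nothing but the delegated unitary. Let $\rho_H(\psi,U)$ and $\rho_D(\psi,U)$ be the average output states of the client with the honest server and with a given attack. Let $\mathcal A$ be the set of available attacks, and assume that the server has access to the last qubit: either $\mathcal A$ contains, for every single-qubit unitary $V$, the attack that applies $\mathbb 1^{\otimes (k-1)}\otimes V$ before the delegated unitary in every round, or $\mathcal A$ contains, for every $V$, the attack that does so after the delegated unitary in every round. Let $\varepsilon_H,\varepsilon_D\in\mathbb R$. Suppose that for all states $\psi$ and unitaries $U$ on $\mathcal X$, with $U(\psi)=U\psi U^\dagger$, $$\tfrac12\left\|\rho_H(\psi,U)-U(\psi)\right\|_1\le\varepsilon_H,$$ and that for every attack in $\mathcal A$ and all such $\psi$ and $U$ $$\min_{p\in[0,1]}\tfrac12\left\|\rho_D(\psi,U)-\bigl(p\,U(\psi)+(1-p)|\bot\rangle\langle\bot|\bigr)\right\|_1\le\varepsilon_D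 .$$ If the expected number of test rounds $N=\sum_{n}\Omega(n)\,n\in[0,\infty]$ satisfies $N\ge\tfrac12$, then $$\varepsilon_H+\varepsilon_D\ \ge\ \frac1{4N}$$ (where $\frac1{4N}=0$ if $N=\infty$). -/

import Mathlib

noncomputable section

namespace CutAndChoose

open scoped ENNReal Kronecker ComplexOrder

/-! ## States, channels, trace norm -/

/-- The computational basis of `k` qubits. The space `ℂ^(2^k)` is indexed by it. -/
abbrev Qubits (k : ℕ) : Type := Fin k → Fin 2

/-- A density matrix. -/
def IsDensity {a : Type} [Fintype a] (ρ : Matrix a a ℂ) : Prop :=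
  ρ.PosSemidef ∧ ρ.trace = 1

/-- A measurement operator `0 ≤ μ ≤ 1`. -/
def IsEffect {a : Type} [DecidableEq a] (μ : Matrix a a ℂ) : Prop :=
  μ.PosSemidef ∧ (1 - μ).PosSemidef

/-- `Φ ⊗ id` on `A ⊗ R`, for a linear map `Φ` of operators on `A`. -/
def ampl {a b : Type} (Φ : Matrix a a ℂ →ₗ[ℂ] Matrix b b ℂ) (R : Type) :
    Matrix (a × R) (a × R) ℂ →ₗ[ℂ] Matrix (b × R) (b × R) ℂ where
  toFun ρ := Matrix.of fun s t => Φ (Matrix.of fun x y => ρ (x, s.2) (y, t.2)) s.1 t.1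
  map_add' ρ σ := by
    ext s t
    exact congrFun₂ (map_add Φ (Matrix.of fun x y => ρ (x, s.2) (y, t.2))
      (Matrix.of fun x y => σ (x, s.2) (y, t.2))) s.1 t.1
  map_smul' c ρ := by
    ext s t
    exact congrFun₂ (map_smul Φ c (Matrix.of fun x y => ρ (x, s.2) (y, t.2))) s.1 t.1

/-- A quantum channel: a completely positive and trace preserving linear map. -/
structure Channel (a b : Type) [Fintype a] [Fintype b] where
  map : Matrix a a ℂ →ₗ[ℂ] Matrix b b ℂ
  completelyPositive : ∀ (R : Type) [Fintype R] (ρ : Matrix (a × R) (a × R) ℂ),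
    ρ.PosSemidef → (ampl map R ρ).PosSemidef
  tracePreserving : ∀ ρ : Matrix a a ℂ, (map ρ).trace = ρ.trace

/-- `ρ ↦ K ρ K†`. -/
def conj {a : Type} [Fintype a] (K : Matrix a a ℂ) : Matrix a a ℂ →ₗ[ℂ] Matrix a a ℂ where
  toFun ρ := K * ρ * K.conjTranspose
  map_add' ρ σ := by rw [Matrix.mul_add, Matrix.add_mul]
  map_smul' c ρ := by simp

theorem ampl_conj {a : Type} [Fintype a] (K : Matrix a a ℂ) (R : Type) [Fintype R]
    [DecidableEq R] (ρ : Matrix (a × R) (a × R) ℂ) :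
    ampl (conj K) R ρ =
      (K ⊗ₖ (1 : Matrix R R ℂ)) * ρ * (K ⊗ₖ (1 : Matrix R R ℂ)).conjTranspose := by
  ext ⟨x, r⟩ ⟨y, s⟩
  simp [ampl, conj, Matrix.mul_apply, Fintype.sum_prod_type, Matrix.kroneckerMap_apply,
    Matrix.one_apply, Finset.sum_mul, apply_ite (starRingEnd ℂ)]

/-- Conjugation by a unitary, as a channel. -/
def unitaryChannel {a : Type} [Fintype a] [DecidableEq a] (U : Matrix.unitaryGroup a ℂ) :
    Channel a a where
  map := conj (U : Matrix a a ℂ)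
  completelyPositive R _ ρ hρ := by
    classical
    rw [ampl_conj]
    exact hρ.mul_mul_conjTranspose_same _
  tracePreserving ρ := by
    have h : (U : Matrix a a ℂ).conjTranspose * (U : Matrix a a ℂ) = 1 :=
      Matrix.mem_unitaryGroup_iff'.mp U.2
    simp only [conj, LinearMap.coe_mk, AddHom.coe_mk]
    rw [Matrix.trace_mul_comm, ← Matrix.mul_assoc, h, Matrix.one_mul]

section TraceNorm

open scoped MatrixOrder

/-- The trace norm `‖A‖₁ = Tr √(A† A)`. -/
def traceNorm {a : Type} [Fintype a] [DecidableEq a] (A : Matrix a a ℂ) : ℝ :=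
  (CFC.sqrt (A.conjTranspose * A)).trace.re

end TraceNorm

/-- Apply `Φ` to the tensor factor `A` of a system `S ≅ A ⊗ R`; the result lives on
`S' ≅ B ⊗ R`. -/
def applyOn {S S' a b R : Type} (e : S ≃ a × R) (e' : S' ≃ b × R)
    (Φ : Matrix a a ℂ →ₗ[ℂ] Matrix b b ℂ) (ρ : Matrix S S ℂ) : Matrix S' S' ℂ :=
  (ampl Φ R (ρ.submatrix e.symm e.symm)).submatrix e' e'

/-! ## Single-qubit unitaries inside a register of `k` qubits -/

/-- The tensor product `A 0 ⊗ A 1 ⊗ ⋯ ⊗ A (k-1)` of single-qubit matrices. -/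
def tensor {k : ℕ} (A : Fin k → Matrix (Fin 2) (Fin 2) ℂ) :
    Matrix (Qubits k) (Qubits k) ℂ :=
  Matrix.of fun x y => ∏ i, A i (x i) (y i)

theorem tensor_mul {k : ℕ} (A B : Fin k → Matrix (Fin 2) (Fin 2) ℂ) :
    tensor A * tensor B = tensor fun i => A i * B i := by
  ext x y
  simp only [tensor, Matrix.mul_apply, Matrix.of_apply, ← Finset.prod_mul_distrib]
  rw [Finset.prod_univ_sum, Fintype.piFinset_univ]

theorem tensor_one {k : ℕ} :
    tensor (fun _ : Fin k => (1 : Matrix (Fin 2) (Fin 2) ℂ)) = 1 := by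
  ext x y
  simp only [tensor, Matrix.of_apply, Matrix.one_apply, Finset.prod_ite_zero,
    Finset.prod_const_one, Finset.mem_univ, forall_const, funext_iff]

theorem tensor_conjTranspose {k : ℕ} (A : Fin k → Matrix (Fin 2) (Fin 2) ℂ) :
    (tensor A).conjTranspose = tensor fun i => (A i).conjTranspose := by
  ext x y
  simp [tensor, Matrix.conjTranspose_apply]

/-- `1 ⊗ ⋯ ⊗ 1 ⊗ V`: the unitary `V` on the last of `k ≥ 1` qubits. -/
def onLastQubit {k : ℕ} (hk : 0 < k) (V : Matrix.unitaryGroup (Fin 2) ℂ) :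
    Matrix.unitaryGroup (Qubits k) ℂ :=
  ⟨tensor fun i =>
      if i = ⟨k - 1, Nat.sub_lt hk Nat.one_pos⟩ then (V : Matrix (Fin 2) (Fin 2) ℂ) else 1, by
    rw [Matrix.mem_unitaryGroup_iff, Matrix.star_eq_conjTranspose, tensor_conjTranspose,
      tensor_mul, ← tensor_one]
    congr 1
    funext i
    split_ifs
    · exact Matrix.mem_unitaryGroup_iff.mp V.2
    · simp⟩

/-! ## The client: combs, tests, protocols -/

/-- An `n`-comb with input system `A`, output system `B` and `n` holes on the system `X`:
`n + 1` channels (the teeth) which are connected by the holes and by memory systems of finite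
dimension. A `0`-comb is one channel `A → B`; an `(n+1)`-comb is a channel `A → X ⊗ M`,
followed by a hole on `X` and an `n`-comb with input system `X ⊗ M`. -/
inductive Comb (X B : Type) [Fintype X] [Fintype B] : ℕ → (A : Type) → [Fintype A] → Type 1
  | last {A : Type} [Fintype A] (Φ : Channel A B) : Comb X B 0 A
  | cons {n : ℕ} {A : Type} [Fintype A] {m : ℕ} (Φ : Channel A (X × Fin m))
      (rest : Comb X B n (X × Fin m)) : Comb X B (n + 1) A

/-- What the client uses to test the server when the number `n` of test rounds and the output
round are fixed: `W` registers of `k` qubits, a system `Y` of dimension `y` that the client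
keeps, the state `χ` of all of them, an `n`-comb on the `W` registers, the unitaries `T` that
are delegated in its holes, and the operator `μ` that corresponds to acceptance. -/
structure TestStrategy (k n : ℕ) where
  W : ℕ
  y : ℕ
  χ : Matrix ((Fin W → Qubits k) × Fin y) ((Fin W → Qubits k) × Fin y) ℂ
  isDensity : IsDensity χ
  comb : Comb (Qubits k) (Fin W → Qubits k) n (Fin W → Qubits k)
  T : Fin n → Matrix.unitaryGroup (Qubits k) ℂ
  μ : Matrix ((Fin W → Qubits k) × Fin y) ((Fin W → Qubits k) × Fin y) ℂ
  isEffect : IsEffect μ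

/-- The client's side of a cut-and-choose protocol with general tests: the distribution `Ω` of
the number of test rounds, the distributions `ω n` of the output round among the `n + 1` rounds
(numbered from `0`), and the tests. -/
structure Protocol (k : ℕ) where
  Ω : PMF ℕ
  ω : (n : ℕ) → PMF (Fin (n + 1))
  test : (n : ℕ) → Fin (n + 1) → TestStrategy k n

/-- The expected number of test rounds. -/
def Protocol.expectedTests {k : ℕ} (P : Protocol k) : ℝ≥0∞ :=
  ∑' n : ℕ, P.Ω n * (n : ℝ≥0∞)

/-! ## The server -/

/-- A behaviour of the server. It holds a memory of dimension `dim`; in round `i` it applies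
`pre i` to the register that it gets and its memory, then the delegated unitary is carried out
on the register, and then it applies `post i`. -/
structure Server (k : ℕ) where
  dim : ℕ
  init : Matrix (Fin dim) (Fin dim) ℂ
  isDensity : IsDensity init
  pre : ℕ → Channel (Qubits k × Fin dim) (Qubits k × Fin dim)
  post : ℕ → Channel (Qubits k × Fin dim) (Qubits k × Fin dim)

/-- `U ⊗ 1` on a register and a trivial memory. -/
def withTrivialMemory {X : Type} [Fintype X] [DecidableEq X] (U : Matrix.unitaryGroup X ℂ) :
    Matrix.unitaryGroup (X × Fin 1) ℂ :=
  ⟨(U : Matrix X X ℂ) ⊗ₖ (1 : Matrix (Fin 1) (Fin 1) ℂ),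
    Matrix.kronecker_mem_unitary U.2 (one_mem _)⟩

/-- The server without memory that applies the unitary `A` before and the unitary `B` after the
delegated unitary, in every round. -/
def iidServer {k : ℕ} (A B : Matrix.unitaryGroup (Qubits k) ℂ) : Server k where
  dim := 1
  init := 1
  isDensity := ⟨Matrix.PosSemidef.one, by simp⟩
  pre _ := unitaryChannel (withTrivialMemory A)
  post _ := unitaryChannel (withTrivialMemory B)

/-- The honest server only carries out the delegated unitaries. -/
def honestServer (k : ℕ) : Server k := iidServer 1 1

/-- The delegation of `U` in round `i`, on the delegated register and the server's memory. -/
def Server.delegate {k : ℕ} (S : Server k) (i : ℕ) (U : Matrix.unitaryGroup (Qubits k) ℂ) :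
    Matrix (Qubits k × Fin S.dim) (Qubits k × Fin S.dim) ℂ →ₗ[ℂ]
      Matrix (Qubits k × Fin S.dim) (Qubits k × Fin S.dim) ℂ :=
  (S.post i).map ∘ₗ ampl (conj (U : Matrix (Qubits k) (Qubits k) ℂ)) (Fin S.dim) ∘ₗ (S.pre i).map

/-! ## Running the protocol

The joint system is `A ⊗ (Y ⊗ R ⊗ E)` with `A` the current system of the comb, `Y` the system
that the client keeps, `R` the client's input register and `E` the server's memory. -/

/-- Rearrangement for a delegation in a hole of the comb, whose current system is `X ⊗ M`. -/
def holeEquiv (X M Y R E : Type) :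
    (X × M) × (Y × R × E) ≃ (X × E) × (M × Y × R) where
  toFun s := ((s.1.1, s.2.2.2), (s.1.2, s.2.1, s.2.2.1))
  invFun s := ((s.1.1, s.2.1), (s.2.2.1, s.2.2.2, s.1.2))
  left_inv _ := rfl
  right_inv _ := rfl

/-- Rearrangement for a delegation on the client's input register. -/
def inputEquiv (A Y R E : Type) : A × (Y × R × E) ≃ (R × E) × (A × Y) where
  toFun s := ((s.2.2.1, s.2.2.2), (s.1, s.2.1))
  invFun s := (s.2.1, (s.2.2, s.1.1, s.1.2))
  left_inv _ := rfl
  right_inv _ := rfl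

/-- The output round, in round `i`: `U` is delegated on the client's input register. -/
def outputRound {k : ℕ} (S : Server k) (U : Matrix.unitaryGroup (Qubits k) ℂ) (i : ℕ)
    {A Y : Type} (ρ : Matrix (A × (Y × Qubits k × Fin S.dim)) (A × (Y × Qubits k × Fin S.dim)) ℂ) :
    Matrix (A × (Y × Qubits k × Fin S.dim)) (A × (Y × Qubits k × Fin S.dim)) ℂ :=
  applyOn (inputEquiv A Y (Qubits k) (Fin S.dim)) (inputEquiv A Y (Qubits k) (Fin S.dim))
    (S.delegate i U) ρ

/-- A test round, in round `i`: `T` is delegated in a hole of the comb. -/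
def testRound {k : ℕ} (S : Server k) (T : Matrix.unitaryGroup (Qubits k) ℂ) (i : ℕ)
    {M Y : Type}
    (ρ : Matrix ((Qubits k × M) × (Y × Qubits k × Fin S.dim))
      ((Qubits k × M) × (Y × Qubits k × Fin S.dim)) ℂ) :
    Matrix ((Qubits k × M) × (Y × Qubits k × Fin S.dim))
      ((Qubits k × M) × (Y × Qubits k × Fin S.dim)) ℂ :=
  applyOn (holeEquiv (Qubits k) M Y (Qubits k) (Fin S.dim))
    (holeEquiv (Qubits k) M Y (Qubits k) (Fin S.dim)) (S.delegate i T) ρ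

/-- The remaining rounds, when `j` tests have been made and the given comb is what is left. The
output round is round `ℓ`: it takes place after `ℓ` tests. Test number `j` takes place in round
`j` if `j < ℓ`, and in round `j + 1` otherwise. -/
def runComb {k : ℕ} (S : Server k) (U : Matrix.unitaryGroup (Qubits k) ℂ) (ℓ : ℕ)
    {B Y : Type} [Fintype B] : {n : ℕ} → {A : Type} → [Fintype A] → Comb (Qubits k) B n A →
    (Fin n → Matrix.unitaryGroup (Qubits k) ℂ) → (j : ℕ) →
    Matrix (A × (Y × Qubits k × Fin S.dim)) (A × (Y × Qubits k × Fin S.dim)) ℂ →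
    Matrix (B × (Y × Qubits k × Fin S.dim)) (B × (Y × Qubits k × Fin S.dim)) ℂ
  | _, _, _, @Comb.last _ _ _ _ _ _ Φ, _, j, ρ =>
      ampl Φ.map _ (if j = ℓ then outputRound S U ℓ ρ else ρ)
  | _, _, _, @Comb.cons _ _ _ _ _ _ _ _ Φ rest, T, j, ρ =>
      runComb S U ℓ rest (fun i => T i.succ) (j + 1)
        (testRound S (T 0) (if j < ℓ then j else j + 1)
          (ampl Φ.map _ (if j = ℓ then outputRound S U ℓ ρ else ρ)))

/-- The product state `χ ⊗ ψ ⊗ τ`. -/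
def initialState {B Y R E : Type} (χ : Matrix (B × Y) (B × Y) ℂ) (ψ : Matrix R R ℂ)
    (τ : Matrix E E ℂ) : Matrix (B × (Y × R × E)) (B × (Y × R × E)) ℂ :=
  Matrix.of fun s t =>
    χ (s.1, s.2.1) (t.1, t.2.1) * ψ s.2.2.1 t.2.2.1 * τ s.2.2.2 t.2.2.2

/-- `Tr_{B Y E} [(μ ⊗ 1) ρ]`, the unnormalized state of `R` when the outcome of the measurement
on `B ⊗ Y` is the one of `μ`. -/
def postMeasurement {B Y R E : Type} [Fintype B] [Fintype Y] [Fintype E]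
    (μ : Matrix (B × Y) (B × Y) ℂ) (ρ : Matrix (B × (Y × R × E)) (B × (Y × R × E)) ℂ) :
    Matrix R R ℂ :=
  Matrix.of fun r r' => ∑ e : E,
    (μ * Matrix.of fun s t : B × Y => ρ (s.1, s.2, r, e) (t.1, t.2, r', e)).trace

/-- The joint state before the client's measurement, when the number `n` of tests and the output
round `ℓ` are fixed. -/
def finalState {k n : ℕ} (t : TestStrategy k n) (ℓ : Fin (n + 1)) (S : Server k)
    (ψ : Matrix (Qubits k) (Qubits k) ℂ) (U : Matrix.unitaryGroup (Qubits k) ℂ) :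
    Matrix ((Fin t.W → Qubits k) × (Fin t.y × Qubits k × Fin S.dim))
      ((Fin t.W → Qubits k) × (Fin t.y × Qubits k × Fin S.dim)) ℂ :=
  runComb S U ℓ t.comb t.T 0 (initialState t.χ ψ S.init)

/-- `σ ⊕ q |⊥⟩⟨⊥|`, on the output space: `k` qubits plus one dimension for the abort symbol
`⊥`, which is orthogonal to them. -/
def withAbort {k : ℕ} (σ : Matrix (Qubits k) (Qubits k) ℂ) (q : ℂ) :
    Matrix (Qubits k ⊕ Unit) (Qubits k ⊕ Unit) ℂ :=
  Matrix.fromBlocks σ 0 0 (Matrix.of fun _ _ => q)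

/-- The client's output when `n` and `ℓ` are fixed: the output register if the client accepts,
and `⊥` otherwise. -/
def conditionalOutput {k n : ℕ} (t : TestStrategy k n) (ℓ : Fin (n + 1)) (S : Server k)
    (ψ : Matrix (Qubits k) (Qubits k) ℂ) (U : Matrix.unitaryGroup (Qubits k) ℂ) :
    Matrix (Qubits k ⊕ Unit) (Qubits k ⊕ Unit) ℂ :=
  withAbort (postMeasurement t.μ (finalState t ℓ S ψ U))
    (postMeasurement (1 - t.μ) (finalState t ℓ S ψ U)).trace

/-- The client's average output state on the input state `ψ` and the unitary `U`, against the
server `S`. -/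
def Protocol.output {k : ℕ} (P : Protocol k) (S : Server k)
    (ψ : Matrix (Qubits k) (Qubits k) ℂ) (U : Matrix.unitaryGroup (Qubits k) ℂ) :
    Matrix (Qubits k ⊕ Unit) (Qubits k ⊕ Unit) ℂ :=
  ∑' n : ℕ, (P.Ω n).toReal •
    ∑ ℓ : Fin (n + 1), (P.ω n ℓ).toReal • conditionalOutput (P.test n ℓ) ℓ S ψ U

/-- `p U(ψ) + (1 - p) |⊥⟩⟨⊥|`. -/
def idealOutput {k : ℕ} (ψ : Matrix (Qubits k) (Qubits k) ℂ)
    (U : Matrix.unitaryGroup (Qubits k) ℂ) (p : ℝ) :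
    Matrix (Qubits k ⊕ Unit) (Qubits k ⊕ Unit) ℂ :=
  withAbort ((p : ℂ) • conj (U : Matrix (Qubits k) (Qubits k) ℂ) ψ) ((1 - p : ℝ) : ℂ)

/-! ## Correctness and security in trace distance -/

/-- With the honest server, the output is `ε`-close to `U(ψ)`, for all `ψ` and `U`. -/
def Protocol.IsCorrect {k : ℕ} (P : Protocol k) (ε : ℝ) : Prop :=
  ∀ (ψ : Matrix (Qubits k) (Qubits k) ℂ) (U : Matrix.unitaryGroup (Qubits k) ℂ), IsDensity ψ →
    1 / 2 * traceNorm (P.output (honestServer k) ψ U - idealOutput ψ U 1) ≤ ε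

/-- With any server among the `attacks`, the output is `ε`-close to a mixture of `U(ψ)` and an
abort, for all `ψ` and `U`. -/
def Protocol.IsSecure {k : ℕ} (P : Protocol k) (attacks : Set (Server k)) (ε : ℝ) : Prop :=
  ∀ S ∈ attacks,
    ∀ (ψ : Matrix (Qubits k) (Qubits k) ℂ) (U : Matrix.unitaryGroup (Qubits k) ℂ), IsDensity ψ →
      ⨅ p : Set.Icc (0 : ℝ) 1,
        1 / 2 * traceNorm (P.output S ψ U - idealOutput ψ U p) ≤ ε

/-- The server is able to apply any unitary to the last qubit of each register that it gets,
before the delegated unitary, or it is able to do so after the delegated unitary. -/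
def HasLastQubitAccess {k : ℕ} (hk : 0 < k) (attacks : Set (Server k)) : Prop :=
  (∀ V : Matrix.unitaryGroup (Fin 2) ℂ, iidServer (onLastQubit hk V) 1 ∈ attacks) ∨
    (∀ V : Matrix.unitaryGroup (Fin 2) ℂ, iidServer 1 (onLastQubit hk V) ∈ attacks)

end CutAndChoose

end

noncomputable section

namespace CutAndChoose

open scoped ENNReal Kronecker ComplexOrder

/-! ## Traces of products and the trace norm -/

/-! The attack applies the phase gate `diag (1, z)` to the last qubit in every round, on whichever
side of the delegated unitary the server can reach. A memoryless attack `iidServer A B` keeps the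
output register and the test in a product state, so the client's output is exactly an ideal output
for the wrong unitary `B * U * A`, with an acceptance probability independent of `ψ` and `U`
(`Protocol.output_iidServer`).

Two estimates compete. Detection: as a function of the phase in a single hole, the acceptance
probability is a trigonometric polynomial of degree one with values in `[0, 1]`, so its amplitude is
at most `1/2` and it moves by at most `‖z - 1‖ / 2` (`abs_sub_le_of_bounded_on_circle`). Replacing
the holes one by one and averaging over the client's choices, acceptance drops by at most `N ‖z - 1‖
/ 2` (`combRun_lipschitz`, `Protocol.acceptance_le_add`). Damage: on `|0…0⟩ + |0…01⟩` the phase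
moves the output by trace distance `‖z - 1‖ / 2`, and mixing in the abort symbol does not help the
ideal state, so acceptance times `‖z - 1‖ / 2` is at most `εD`
(`Protocol.IsSecure.acceptance_mul_le`).

Correctness bounds the honest acceptance `a` below by `1 - εH`. Take `‖z - 1‖ = 1 / N` and `c = 1 /
(2N) ≤ 1`. Then `εH + εD ≥ (1 - a) + c (a - 1/2) ≥ c / 2 = 1 / (4N)`. -/

open scoped MatrixOrder in
theorem trace_mul_re_nonneg {a : Type} [Fintype a] {E A : Matrix a a ℂ}
    (hE : E.PosSemidef) (hA : A.PosSemidef) : 0 ≤ (E * A).trace.re := by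
  classical
  obtain ⟨B, rfl⟩ := CStarAlgebra.nonneg_iff_eq_star_mul_self.mp hA.nonneg
  rw [← Matrix.mul_assoc, Matrix.trace_mul_comm, ← Matrix.mul_assoc]
  exact (Complex.le_def.mp (hE.mul_mul_conjTranspose_same B).trace_nonneg).1

theorem trace_mul_density_re_mem {a : Type} [Fintype a] [DecidableEq a] {E ρ : Matrix a a ℂ}
    (hE : IsEffect E) (hρ : IsDensity ρ) : (E * ρ).trace.re ∈ Set.Icc (0 : ℝ) 1 := by
  refine ⟨trace_mul_re_nonneg hE.1 hρ.1, ?_⟩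
  have h := trace_mul_re_nonneg hE.2 hρ.1
  rw [Matrix.sub_mul, Matrix.trace_sub, Matrix.one_mul, hρ.2] at h
  simpa using h

section TraceNorm

open scoped MatrixOrder

/-- The witness is `|A|`: `|A| - A` and `|A| + A` are twice the negative and the positive part of
`A`. -/
theorem exists_abs {a : Type} [Fintype a] [DecidableEq a] {A : Matrix a a ℂ}
    (hA : A.IsHermitian) : ∃ B : Matrix a a ℂ,
      (B - A).PosSemidef ∧ (B + A).PosSemidef ∧ traceNorm A = B.trace.re := by
  have hsa : IsSelfAdjoint A := hA
  refine ⟨CFC.abs A, ?_, ?_, rfl⟩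
  · rw [CFC.abs_sub_self A hsa, ← Matrix.nonneg_iff_posSemidef]
    exact nsmul_nonneg (CFC.negPart_nonneg A) 2
  · rw [CFC.abs_add_self A hsa, ← Matrix.nonneg_iff_posSemidef]
    exact nsmul_nonneg (CFC.posPart_nonneg A) 2

end TraceNorm

/-- Pair `E` with `|A| - A` and `1 - E` with `|A| + A`. In the sum of the two nonnegative traces the
terms `E * |A|` cancel. -/
theorem trace_mul_effect_le_traceNorm {a : Type} [Fintype a] [DecidableEq a]
    {A E : Matrix a a ℂ} (hA : A.IsHermitian) (htr : A.trace = 0) (hE : IsEffect E) :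
    (E * A).trace.re ≤ 1 / 2 * traceNorm A := by
  obtain ⟨B, h₁, h₂, hB⟩ := exists_abs hA
  have e₁ := trace_mul_re_nonneg hE.1 h₁
  have e₂ := trace_mul_re_nonneg hE.2 h₂
  simp only [Matrix.mul_sub, Matrix.mul_add, Matrix.sub_mul, Matrix.one_mul, Matrix.trace_sub,
    Matrix.trace_add, htr, Complex.sub_re, Complex.add_re, Complex.zero_re] at e₁ e₂
  rw [hB]
  linarith

/-! ## Amplified channels -/

theorem isDensity_ampl {a b R : Type} [Fintype a] [Fintype b] [Fintype R] (Φ : Channel a b)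
    {ρ : Matrix (a × R) (a × R) ℂ} (hρ : IsDensity ρ) : IsDensity (ampl Φ.map R ρ) := by
  refine ⟨Φ.completelyPositive R ρ hρ.1, ?_⟩
  rw [← hρ.2]
  simp only [Matrix.trace, Matrix.diag, Fintype.sum_prod_type_right, ampl, LinearMap.coe_mk,
    AddHom.coe_mk, Matrix.of_apply]
  exact Finset.sum_congr rfl fun r _ =>
    Φ.tracePreserving (Matrix.of fun x y => ρ (x, r) (y, r))

/-- Conjugation of the register `X` of `(X ⊗ M) ⊗ Y`. -/
def registerMap {X : Type} [Fintype X] (K : Matrix X X ℂ) (M Y : Type) :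
    Matrix ((X × M) × Y) ((X × M) × Y) ℂ →ₗ[ℂ] Matrix ((X × M) × Y) ((X × M) × Y) ℂ :=
  ampl (ampl (conj K) M) Y

theorem isDensity_submatrix {a b : Type} [Fintype a] [Fintype b] {ρ : Matrix a a ℂ}
    (hρ : IsDensity ρ) (e : b ≃ a) : IsDensity (ρ.submatrix e e) := by
  refine ⟨hρ.1.submatrix e, ?_⟩
  rw [← hρ.2]
  exact e.sum_comp fun i => ρ i i

theorem isDensity_registerMap {X M Y : Type} [Fintype X] [DecidableEq X] [Fintype M] [Fintype Y]
    (W : Matrix.unitaryGroup X ℂ) {ρ : Matrix ((X × M) × Y) ((X × M) × Y) ℂ}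
    (hρ : IsDensity ρ) : IsDensity (registerMap (W : Matrix X X ℂ) M Y ρ) :=
  -- Regrouped as `X × (M × Y)`, the double amplification is a single one, by definition.
  isDensity_submatrix (isDensity_ampl (unitaryChannel W)
    (isDensity_submatrix hρ (Equiv.prodAssoc X M Y).symm)) (Equiv.prodAssoc X M Y)

/-- `ρ ↦ K ρ L†`. -/
def sandwich {a : Type} [Fintype a] (K L : Matrix a a ℂ) : Matrix a a ℂ →ₗ[ℂ] Matrix a a ℂ where
  toFun ρ := K * ρ * L.conjTranspose
  map_add' ρ σ := by rw [Matrix.mul_add, Matrix.add_mul]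
  map_smul' c ρ := by simp

/-- The term quadratic in `z` is `z * conj z = 1` times `conj L`, so on the unit circle only the
frequencies `0`, `1` and `-1` occur. -/
theorem conj_add_smul {a : Type} [Fintype a] (K L : Matrix a a ℂ) {z : ℂ} (hz : ‖z‖ = 1) :
    conj (K + z • L) = (conj K + conj L) + z • sandwich L K + (starRingEnd ℂ z) • sandwich K L := by
  have h : z * (starRingEnd ℂ) z = 1 := by
    rw [Complex.mul_conj, Complex.normSq_eq_norm_sq, hz]; simp
  refine LinearMap.ext fun ρ => ?_
  simp only [conj, sandwich, LinearMap.coe_mk, AddHom.coe_mk, LinearMap.add_apply,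
    LinearMap.smul_apply, Matrix.conjTranspose_add, Matrix.conjTranspose_smul, Matrix.add_mul,
    Matrix.mul_add, Matrix.smul_mul, Matrix.mul_smul, Complex.star_def]
  rw [smul_add, smul_smul, mul_comm _ z, h, one_smul]
  abel

theorem ampl_add {a b : Type} (Φ Ψ : Matrix a a ℂ →ₗ[ℂ] Matrix b b ℂ) (R : Type) :
    ampl (Φ + Ψ) R = ampl Φ R + ampl Ψ R := rfl

theorem ampl_smul {a b : Type} (c : ℂ) (Φ : Matrix a a ℂ →ₗ[ℂ] Matrix b b ℂ) (R : Type) :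
    ampl (c • Φ) R = c • ampl Φ R := rfl

/-! ## A Bernstein inequality in degree one -/

theorem abs_sub_le_of_bounded_on_circle {α β γ : ℂ}
    (h : ∀ z : ℂ, ‖z‖ = 1 → (α + z * β + starRingEnd ℂ z * γ).re ∈ Set.Icc (0 : ℝ) 1)
    (z : ℂ) :
    |(α + z * β + starRingEnd ℂ z * γ).re - (α + 1 * β + starRingEnd ℂ 1 * γ).re|
      ≤ ‖z - 1‖ / 2 := by
  -- Under the real part, the frequencies `1` and `-1` merge into one coefficient.
  set d : ℂ := β + starRingEnd ℂ γ with hd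
  have key : ∀ z : ℂ, (α + z * β + starRingEnd ℂ z * γ).re = α.re + (z * d).re := fun z => by
    simp [hd]; ring
  have hd2 : ‖d‖ ≤ 1 / 2 := by
    rcases eq_or_ne d 0 with h0 | h0
    · simp [h0]
    have hn : (‖d‖ : ℂ) ≠ 0 := by simpa using h0
    -- The values at `w` and `-w` are `α.re + ‖d‖` and `α.re - ‖d‖`. Both lie in `[0, 1]`, so `‖d‖ ≤
    -- 1 / 2`.
    set w : ℂ := starRingEnd ℂ d / ‖d‖ with hw
    have hw1 : ‖w‖ = 1 := by
      simp [hw, h0]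
    have hwd : w * d = ‖d‖ := by
      rw [hw, div_mul_eq_mul_div, mul_comm, Complex.mul_conj, Complex.normSq_eq_norm_sq]
      push_cast
      field_simp
    have h₁ := (h w hw1).2
    have h₂ := (h (-w) (by simpa using hw1)).1
    rw [key] at h₁ h₂
    rw [neg_mul, hwd] at h₂
    rw [hwd] at h₁
    simp at h₁ h₂
    linarith
  rw [key, key]
  calc |α.re + (z * d).re - (α.re + (1 * d).re)| = |((z - 1) * d).re| := by
        congr 1; simp; ring
    _ ≤ ‖(z - 1) * d‖ := Complex.abs_re_le_norm _
    _ = ‖z - 1‖ * ‖d‖ := norm_mul _ _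
    _ ≤ ‖z - 1‖ * (1 / 2) := by gcongr
    _ = ‖z - 1‖ / 2 := by ring

/-- A measurement probability that depends on one use of the unitary `K + z L`. -/
theorem registerMap_lipschitz {X M Y : Type} [Fintype X] [DecidableEq X] [Fintype M] [Fintype Y]
    (f : Matrix ((X × M) × Y) ((X × M) × Y) ℂ →ₗ[ℂ] ℂ)
    (hf : ∀ ρ, IsDensity ρ → (f ρ).re ∈ Set.Icc (0 : ℝ) 1) {K L : Matrix X X ℂ}
    (hKL : ∀ z : ℂ, ‖z‖ = 1 → K + z • L ∈ Matrix.unitaryGroup X ℂ)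
    {ρ : Matrix ((X × M) × Y) ((X × M) × Y) ℂ} (hρ : IsDensity ρ) {z : ℂ} (hz : ‖z‖ = 1) :
    |(f (registerMap (K + z • L) M Y ρ)).re - (f (registerMap (K + (1 : ℂ) • L) M Y ρ)).re|
      ≤ ‖z - 1‖ / 2 := by
  have key : ∀ z : ℂ, ‖z‖ = 1 → f (registerMap (K + z • L) M Y ρ) =
      f (ampl (ampl (conj K + conj L) M) Y ρ) + z * f (ampl (ampl (sandwich L K) M) Y ρ)
        + starRingEnd ℂ z * f (ampl (ampl (sandwich K L) M) Y ρ) := fun z hz => by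
    rw [registerMap, conj_add_smul K L hz]
    simp only [ampl_add, ampl_smul, LinearMap.add_apply, LinearMap.smul_apply, map_add, map_smul,
      smul_eq_mul]
  rw [key z hz, key 1 norm_one]
  refine abs_sub_le_of_bounded_on_circle (fun w hw => ?_) z
  rw [← key w hw]
  exact hf _ (isDensity_registerMap ⟨_, hKL w hw⟩ hρ)

/-! ## Running a comb with unitaries in its holes -/

/-- The output of a comb whose holes are filled with conjugations by `K 0, K 1, …`. -/
def combRun {X B : Type} [Fintype X] [Fintype B] (Y : Type) : {n : ℕ} → {A : Type} →
    [Fintype A] → Comb X B n A → (Fin n → Matrix X X ℂ) →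
    Matrix (A × Y) (A × Y) ℂ →ₗ[ℂ] Matrix (B × Y) (B × Y) ℂ
  | _, _, _, @Comb.last _ _ _ _ _ _ Φ, _ => ampl Φ.map Y
  | _, _, _, @Comb.cons _ _ _ _ _ _ _ m Φ rest, K =>
      combRun Y rest (fun i => K i.succ) ∘ₗ registerMap (K 0) (Fin m) Y ∘ₗ ampl Φ.map Y

theorem isDensity_combRun {X B Y : Type} [Fintype X] [DecidableEq X] [Fintype B] [Fintype Y]
    {n : ℕ} {A : Type} [Fintype A] (c : Comb X B n A) (W : Fin n → Matrix.unitaryGroup X ℂ)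
    {ρ : Matrix (A × Y) (A × Y) ℂ} (hρ : IsDensity ρ) :
    IsDensity (combRun Y c (fun i => (W i : Matrix X X ℂ)) ρ) := by
  induction c with
  | last Φ => exact isDensity_ampl Φ hρ
  | cons Φ rest ih =>
    exact ih (fun i => W i.succ) (isDensity_registerMap (W 0) (isDensity_ampl Φ hρ))

/-- Hybrid argument: phases are changed one hole at a time, and every intermediate run still
produces a density matrix, so each change costs at most `‖z - 1‖ / 2`. -/
theorem combRun_lipschitz {X B Y : Type} [Fintype X] [DecidableEq X] [Fintype B] [Fintype Y]
    {n : ℕ} {A : Type} [Fintype A] (c : Comb X B n A)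
    (f : Matrix (B × Y) (B × Y) ℂ →ₗ[ℂ] ℂ)
    (hf : ∀ ρ, IsDensity ρ → (f ρ).re ∈ Set.Icc (0 : ℝ) 1) {K L : Fin n → Matrix X X ℂ}
    (hKL : ∀ i (z : ℂ), ‖z‖ = 1 → K i + z • L i ∈ Matrix.unitaryGroup X ℂ)
    {ρ : Matrix (A × Y) (A × Y) ℂ} (hρ : IsDensity ρ) {z : ℂ} (hz : ‖z‖ = 1) :
    |(f (combRun Y c (fun i => K i + z • L i) ρ)).re
      - (f (combRun Y c (fun i => K i + (1 : ℂ) • L i) ρ)).re| ≤ n * (‖z - 1‖ / 2) := by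
  induction c with
  | last Φ => simp [combRun]
  | @cons n A _ m Φ rest ih =>
    have hΦ := isDensity_ampl Φ hρ
    -- The first hole already carries `z` here; in `h₂` the first hole changes while the later ones
    -- carry `1`.
    have h₁ := ih (fun i => hKL i.succ)
      (isDensity_registerMap (M := Fin m) ⟨_, hKL 0 z hz⟩ hΦ)
    have h₂ := registerMap_lipschitz (M := Fin m)
      (f ∘ₗ combRun Y rest fun i => K i.succ + (1 : ℂ) • L i.succ)
      (fun σ hσ => hf _ (isDensity_combRun rest (fun i => ⟨_, hKL i.succ 1 norm_one⟩) hσ))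
      (hKL 0) hΦ hz
    refine (abs_sub_le _ _ _).trans ((add_le_add h₁ h₂).trans_eq ?_)
    push_cast
    ring

/-! ## The run of the protocol against a server without memory -/

theorem conj_mul {a : Type} [Fintype a] (K L : Matrix a a ℂ) :
    conj (K * L) = conj K ∘ₗ conj L := by
  refine LinearMap.ext fun ρ => ?_
  simp [conj, Matrix.mul_assoc]

theorem ampl_comp {a b c : Type} (Φ : Matrix b b ℂ →ₗ[ℂ] Matrix c c ℂ)
    (Ψ : Matrix a a ℂ →ₗ[ℂ] Matrix b b ℂ) (R : Type) :
    ampl (Φ ∘ₗ Ψ) R = ampl Φ R ∘ₗ ampl Ψ R := rfl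

theorem unitaryChannel_withTrivialMemory {X : Type} [Fintype X] [DecidableEq X]
    (U : Matrix.unitaryGroup X ℂ) :
    (unitaryChannel (withTrivialMemory U)).map = ampl (conj (U : Matrix X X ℂ)) (Fin 1) :=
  LinearMap.ext fun ρ => (ampl_conj _ _ ρ).symm

theorem iidServer_delegate {k : ℕ} (A B : Matrix.unitaryGroup (Qubits k) ℂ) (i : ℕ)
    (U : Matrix.unitaryGroup (Qubits k) ℂ) :
    (iidServer A B).delegate i U =
      ampl (conj ((B * U * A : Matrix.unitaryGroup (Qubits k) ℂ) : Matrix _ _ ℂ)) (Fin 1) := by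
  have h : (iidServer A B).delegate i U = (unitaryChannel (withTrivialMemory B)).map ∘ₗ
      ampl (conj (U : Matrix (Qubits k) (Qubits k) ℂ)) (Fin 1) ∘ₗ
      (unitaryChannel (withTrivialMemory A)).map := rfl
  rw [h, unitaryChannel_withTrivialMemory, unitaryChannel_withTrivialMemory, ← ampl_comp,
    ← ampl_comp, ← conj_mul, ← conj_mul, ← Matrix.mul_assoc]
  rfl

theorem map_of_mul {a b : Type} (Φ : Matrix a a ℂ →ₗ[ℂ] Matrix b b ℂ) (M : a → a → ℂ)
    (c : ℂ) (x y : b) : Φ (Matrix.of fun s t => M s t * c) x y = Φ (Matrix.of M) x y * c := by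
  have h : (Matrix.of fun s t => M s t * c) = c • Matrix.of M := by
    ext s t; simp [mul_comm]
  rw [h, map_smul, Matrix.smul_apply, smul_eq_mul, mul_comm]

theorem ampl_initialState {A B Y R E : Type} (Φ : Matrix A A ℂ →ₗ[ℂ] Matrix B B ℂ)
    (σ : Matrix (A × Y) (A × Y) ℂ) (ψ : Matrix R R ℂ) (τ : Matrix E E ℂ) :
    ampl Φ (Y × R × E) (initialState σ ψ τ) = initialState (ampl Φ Y σ) ψ τ := by
  ext s t
  simp only [ampl, initialState, LinearMap.coe_mk, AddHom.coe_mk, Matrix.of_apply, map_of_mul]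

theorem outputRound_iidServer {k : ℕ} (A B U : Matrix.unitaryGroup (Qubits k) ℂ) (i : ℕ)
    {C Y : Type} (σ : Matrix (C × Y) (C × Y) ℂ) (ψ : Matrix (Qubits k) (Qubits k) ℂ) :
    outputRound (iidServer A B) U i (initialState σ ψ (iidServer A B).init) =
      initialState σ
        (conj ((B * U * A : Matrix.unitaryGroup (Qubits k) ℂ) : Matrix _ _ ℂ) ψ)
        (iidServer A B).init := by
  ext s t
  rw [outputRound, iidServer_delegate]
  generalize (B * U * A).1 = K
  generalize (iidServer A B).init = τ
  -- The rearrangements only rename indices, so this is definitional unfolding.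
  change conj K (Matrix.of fun x y : Qubits k =>
      σ (s.1, s.2.1) (t.1, t.2.1) * ψ x y * τ s.2.2.2 t.2.2.2) s.2.2.1 t.2.2.1 =
    σ (s.1, s.2.1) (t.1, t.2.1) * conj K ψ s.2.2.1 t.2.2.1 * τ s.2.2.2 t.2.2.2
  have h : (Matrix.of fun x y : Qubits k =>
      σ (s.1, s.2.1) (t.1, t.2.1) * ψ x y * τ s.2.2.2 t.2.2.2) =
      (σ (s.1, s.2.1) (t.1, t.2.1) * τ s.2.2.2 t.2.2.2) • ψ := by
    ext x y
    simp only [Matrix.of_apply, Matrix.smul_apply, smul_eq_mul]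
    ring
  rw [h, map_smul, Matrix.smul_apply, smul_eq_mul]
  ring

theorem testRound_iidServer {k : ℕ} (A B T : Matrix.unitaryGroup (Qubits k) ℂ) (i : ℕ)
    {M Y : Type} (σ : Matrix ((Qubits k × M) × Y) ((Qubits k × M) × Y) ℂ)
    (ψ : Matrix (Qubits k) (Qubits k) ℂ) :
    testRound (iidServer A B) T i (initialState σ ψ (iidServer A B).init) =
      initialState
        (registerMap ((B * T * A : Matrix.unitaryGroup (Qubits k) ℂ) : Matrix _ _ ℂ) M Y σ) ψ
        (iidServer A B).init := by
  ext s t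
  rw [testRound, iidServer_delegate]
  generalize (B * T * A).1 = K
  generalize (iidServer A B).init = τ
  change conj K (Matrix.of fun x y : Qubits k =>
      σ ((x, s.1.2), s.2.1) ((y, t.1.2), t.2.1) * ψ s.2.2.1 t.2.2.1 * τ s.2.2.2 t.2.2.2)
      s.1.1 t.1.1 =
    conj K (Matrix.of fun x y : Qubits k => σ ((x, s.1.2), s.2.1) ((y, t.1.2), t.2.1))
      s.1.1 t.1.1 * ψ s.2.2.1 t.2.2.1 * τ s.2.2.2 t.2.2.2
  rw [map_of_mul, map_of_mul]

/-- Against a server without memory, the output register and the system of the test remain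
in a product state. -/
theorem runComb_iidServer {k : ℕ} (A B U : Matrix.unitaryGroup (Qubits k) ℂ) (ℓ : ℕ)
    {D Y : Type} [Fintype D] {n : ℕ} {C : Type} [Fintype C] (c : Comb (Qubits k) D n C)
    (T : Fin n → Matrix.unitaryGroup (Qubits k) ℂ) (j : ℕ) (σ : Matrix (C × Y) (C × Y) ℂ)
    (ψ : Matrix (Qubits k) (Qubits k) ℂ) :
    runComb (iidServer A B) U ℓ c T j (initialState σ ψ (iidServer A B).init) =
      initialState (combRun Y c
          (fun i => ((B * T i * A : Matrix.unitaryGroup (Qubits k) ℂ) : Matrix _ _ ℂ)) σ)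
        (if j ≤ ℓ ∧ ℓ ≤ j + n then
          conj ((B * U * A : Matrix.unitaryGroup (Qubits k) ℂ) : Matrix _ _ ℂ) ψ else ψ)
        (iidServer A B).init := by
  have hout : ∀ {C : Type} (j : ℕ) (σ : Matrix (C × Y) (C × Y) ℂ)
      (ψ : Matrix (Qubits k) (Qubits k) ℂ),
      (if j = ℓ then outputRound (iidServer A B) U ℓ (initialState σ ψ (iidServer A B).init)
        else initialState σ ψ (iidServer A B).init) =
      initialState σ (if j = ℓ then
        conj ((B * U * A : Matrix.unitaryGroup (Qubits k) ℂ) : Matrix _ _ ℂ) ψ else ψ)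
        (iidServer A B).init := fun j σ ψ => by
    split_ifs
    · exact outputRound_iidServer A B U ℓ σ ψ
    · rfl
  -- The condition `j ≤ ℓ ∧ ℓ ≤ j + n` says that the output round is still ahead. `ψ` varies because
  -- that round may precede the rest of the comb.
  induction c generalizing j ψ with
  | last Φ =>
    rw [runComb, hout, ampl_initialState]
    congr 1
    simp only [add_zero, le_antisymm_iff]
  | @cons n C _ m Φ rest ih =>
    rw [runComb, hout, ampl_initialState, testRound_iidServer, ih]
    congr 1
    by_cases h : j = ℓ
    · subst h; simp
    · have : (j + 1 ≤ ℓ ∧ ℓ ≤ j + 1 + n) ↔ (j ≤ ℓ ∧ ℓ ≤ j + (n + 1)) := by omega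
      simp only [h, if_false, this]

theorem postMeasurement_initialState {D Y R E : Type} [Fintype D] [Fintype Y] [Fintype E]
    (μ σ : Matrix (D × Y) (D × Y) ℂ) (ψ : Matrix R R ℂ) {τ : Matrix E E ℂ} (hτ : τ.trace = 1) :
    postMeasurement μ (initialState σ ψ τ) = (μ * σ).trace • ψ := by
  ext r r'
  have h : ∀ e : E, (Matrix.of fun s t : D × Y =>
      initialState σ ψ τ (s.1, s.2, r, e) (t.1, t.2, r', e)) = (ψ r r' * τ e e) • σ := fun e => by
    ext s t
    simp only [initialState, Matrix.of_apply, Matrix.smul_apply, smul_eq_mul]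
    ring
  simp only [postMeasurement, Matrix.of_apply, h, Matrix.mul_smul, Matrix.trace_smul, smul_eq_mul,
    Matrix.smul_apply, mul_assoc]
  rw [← Finset.mul_sum, ← Finset.sum_mul]
  change ψ r r' * (τ.trace * _) = _
  rw [hτ, one_mul, mul_comm]

/-- The probability that the client accepts, when `n` and `ℓ` are fixed and the unitaries `W`
are carried out in the holes of the comb. -/
def acceptance {k n : ℕ} (t : TestStrategy k n)
    (W : Fin n → Matrix (Qubits k) (Qubits k) ℂ) : ℝ :=
  (t.μ * combRun (Fin t.y) t.comb W t.χ).trace.re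

theorem acceptance_mem {k n : ℕ} (t : TestStrategy k n)
    (W : Fin n → Matrix.unitaryGroup (Qubits k) ℂ) :
    acceptance t (fun i => (W i : Matrix _ _ ℂ)) ∈ Set.Icc (0 : ℝ) 1 :=
  trace_mul_density_re_mem t.isEffect (isDensity_combRun t.comb W t.isDensity)

theorem acceptance_lipschitz {k n : ℕ} (t : TestStrategy k n)
    {K L : Fin n → Matrix (Qubits k) (Qubits k) ℂ}
    (hKL : ∀ i (z : ℂ), ‖z‖ = 1 → K i + z • L i ∈ Matrix.unitaryGroup (Qubits k) ℂ)
    {z : ℂ} (hz : ‖z‖ = 1) :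
    |acceptance t (fun i => K i + z • L i) - acceptance t (fun i => K i + (1 : ℂ) • L i)|
      ≤ n * (‖z - 1‖ / 2) :=
  combRun_lipschitz t.comb
    ((Matrix.traceLinearMap _ ℂ ℂ) ∘ₗ LinearMap.mulLeft ℂ t.μ)
    (fun _ hρ => trace_mul_density_re_mem t.isEffect hρ) hKL t.isDensity hz

theorem trace_mul_im_eq_zero {a : Type} [Fintype a] {E A : Matrix a a ℂ}
    (hE : E.IsHermitian) (hA : A.IsHermitian) : (E * A).trace.im = 0 := by
  rw [← Complex.conj_eq_iff_im, ← Complex.star_def, ← Matrix.trace_conjTranspose,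
    Matrix.conjTranspose_mul, hE, hA, Matrix.trace_mul_comm]

theorem trace_conj {k : ℕ} (W : Matrix.unitaryGroup (Qubits k) ℂ)
    (ψ : Matrix (Qubits k) (Qubits k) ℂ) : (conj (W : Matrix _ _ ℂ) ψ).trace = ψ.trace :=
  (unitaryChannel W).tracePreserving ψ

/-- The final state is a product, so the measurement of the test only rescales the output register.
-/
theorem conditionalOutput_iidServer {k n : ℕ} (t : TestStrategy k n) (ℓ : Fin (n + 1))
    (A B U : Matrix.unitaryGroup (Qubits k) ℂ) {ψ : Matrix (Qubits k) (Qubits k) ℂ}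
    (hψ : ψ.trace = 1) :
    conditionalOutput t ℓ (iidServer A B) ψ U =
      idealOutput ψ (B * U * A) (acceptance t fun i =>
        ((B * t.T i * A : Matrix.unitaryGroup (Qubits k) ℂ) : Matrix _ _ ℂ)) := by
  have htr : (iidServer A B).init.trace = 1 := (iidServer A B).isDensity.2
  have hfin : finalState t ℓ (iidServer A B) ψ U = initialState
      (combRun (Fin t.y) t.comb (fun i => (B * t.T i * A).1) t.χ)
      (conj (B * U * A).1 ψ) (iidServer A B).init := by
    rw [finalState, runComb_iidServer, if_pos ⟨Nat.zero_le _, by omega⟩]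
  have hσ := isDensity_combRun t.comb (fun i => B * t.T i * A) t.isDensity
  have hq : (t.μ * combRun (Fin t.y) t.comb (fun i => (B * t.T i * A).1) t.χ).trace =
      (acceptance t fun i => (B * t.T i * A).1 : ℂ) :=
    Complex.ext rfl (trace_mul_im_eq_zero t.isEffect.1.1 hσ.1.1)
  rw [conditionalOutput, idealOutput, hfin, postMeasurement_initialState _ _ _ htr,
    postMeasurement_initialState _ _ _ htr, Matrix.trace_smul, trace_conj, hψ, Matrix.sub_mul,
    Matrix.trace_sub, Matrix.one_mul, hσ.2, hq]
  simp

/-! ## The average over the client's choices -/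

/-- Ideal outputs are affine in `p`, so averaging them over the client's choices just averages `p`.
-/
theorem idealOutput_eq {k : ℕ} (ψ : Matrix (Qubits k) (Qubits k) ℂ)
    (U : Matrix.unitaryGroup (Qubits k) ℂ) (p : ℝ) :
    idealOutput ψ U p = p • withAbort (conj (U : Matrix _ _ ℂ) ψ) (-1) + withAbort 0 1 := by
  ext (i | i) (j | j) <;> simp [idealOutput, withAbort]
  ring

/-- The average over the number of tests and the output round. -/
def Protocol.average {k : ℕ} (P : Protocol k) (q : (n : ℕ) → Fin (n + 1) → ℝ) : ℝ :=
  ∑' n : ℕ, (P.Ω n).toReal * ∑ ℓ : Fin (n + 1), (P.ω n ℓ).toReal * q n ℓ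

theorem hasSum_toReal_pmf {α : Type} (p : PMF α) : HasSum (fun a => (p a).toReal) 1 := by
  have h := ENNReal.hasSum_toReal (f := p) (by rw [p.tsum_coe]; exact ENNReal.one_ne_top)
  rwa [← ENNReal.tsum_toReal_eq fun a => p.apply_ne_top a, p.tsum_coe, ENNReal.toReal_one] at h

theorem sum_toReal_pmf {α : Type} [Fintype α] (p : PMF α) : ∑ a, (p a).toReal = 1 :=
  (hasSum_fintype _).unique (hasSum_toReal_pmf p)

theorem sum_mul_pmf_mem {α : Type} [Fintype α] (p : PMF α) {q : α → ℝ}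
    (hq : ∀ a, q a ∈ Set.Icc (0 : ℝ) 1) :
    ∑ a, (p a).toReal * q a ∈ Set.Icc (0 : ℝ) 1 := by
  refine ⟨Finset.sum_nonneg fun a _ => mul_nonneg ENNReal.toReal_nonneg (hq a).1, ?_⟩
  rw [← sum_toReal_pmf p]
  exact Finset.sum_le_sum fun a _ => mul_le_of_le_one_right ENNReal.toReal_nonneg (hq a).2

theorem Protocol.hasSum_average {k : ℕ} (P : Protocol k) {q : (n : ℕ) → Fin (n + 1) → ℝ}
    (hq : ∀ n ℓ, q n ℓ ∈ Set.Icc (0 : ℝ) 1) :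
    HasSum (fun n => (P.Ω n).toReal * ∑ ℓ : Fin (n + 1), (P.ω n ℓ).toReal * q n ℓ)
      (P.average q) := by
  refine (Summable.of_nonneg_of_le (fun n => ?_) (fun n => ?_)
    (hasSum_toReal_pmf P.Ω).summable).hasSum
  · exact mul_nonneg ENNReal.toReal_nonneg (sum_mul_pmf_mem _ (hq n)).1
  · exact mul_le_of_le_one_right ENNReal.toReal_nonneg (sum_mul_pmf_mem _ (hq n)).2

theorem Protocol.average_mem {k : ℕ} (P : Protocol k) {q : (n : ℕ) → Fin (n + 1) → ℝ}
    (hq : ∀ n ℓ, q n ℓ ∈ Set.Icc (0 : ℝ) 1) : P.average q ∈ Set.Icc (0 : ℝ) 1 := by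
  refine ⟨(P.hasSum_average hq).nonneg fun n => ?_,
    hasSum_le (fun n => ?_) (P.hasSum_average hq) (hasSum_toReal_pmf P.Ω)⟩
  · exact mul_nonneg ENNReal.toReal_nonneg (sum_mul_pmf_mem _ (hq n)).1
  · exact mul_le_of_le_one_right ENNReal.toReal_nonneg (sum_mul_pmf_mem _ (hq n)).2

/-- An error linear in `n` averages to one linear in the expected number of tests; finiteness makes
that series converge in `ℝ`. -/
theorem Protocol.average_le_add {k : ℕ} (P : Protocol k) (hN : P.expectedTests ≠ ⊤)
    {q q' : (n : ℕ) → Fin (n + 1) → ℝ} (hq : ∀ n ℓ, q n ℓ ∈ Set.Icc (0 : ℝ) 1)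
    (hq' : ∀ n ℓ, q' n ℓ ∈ Set.Icc (0 : ℝ) 1) {c : ℝ}
    (h : ∀ n ℓ, q n ℓ ≤ q' n ℓ + n * c) :
    P.average q ≤ P.average q' + P.expectedTests.toReal * c := by
  have hE : HasSum (fun n : ℕ => (P.Ω n).toReal * (n : ℝ)) P.expectedTests.toReal := by
    have h := ENNReal.hasSum_toReal hN
    rw [← ENNReal.tsum_toReal_eq fun n => ENNReal.ne_top_of_tsum_ne_top hN n] at h
    simpa only [Protocol.expectedTests, ENNReal.toReal_mul, ENNReal.toReal_natCast] using h
  refine hasSum_le (fun n => ?_) (P.hasSum_average hq)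
    ((P.hasSum_average hq').add (hE.mul_right c))
  rw [mul_assoc, ← mul_add]
  refine mul_le_mul_of_nonneg_left ?_ ENNReal.toReal_nonneg
  calc ∑ ℓ, (P.ω n ℓ).toReal * q n ℓ
      ≤ ∑ ℓ, (P.ω n ℓ).toReal * (q' n ℓ + n * c) :=
        Finset.sum_le_sum fun ℓ _ => mul_le_mul_of_nonneg_left (h n ℓ) ENNReal.toReal_nonneg
    _ = ∑ ℓ, (P.ω n ℓ).toReal * q' n ℓ + n * c := by
        simp only [mul_add, Finset.sum_add_distrib, ← Finset.sum_mul, sum_toReal_pmf, one_mul]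

/-- The client's acceptance probability against `iidServer A B`. -/
def Protocol.acceptance {k : ℕ} (P : Protocol k) (A B : Matrix.unitaryGroup (Qubits k) ℂ) : ℝ :=
  P.average fun n ℓ => CutAndChoose.acceptance (P.test n ℓ) fun i => (B * (P.test n ℓ).T i * A).1

theorem Protocol.output_iidServer {k : ℕ} (P : Protocol k)
    (A B U : Matrix.unitaryGroup (Qubits k) ℂ) {ψ : Matrix (Qubits k) (Qubits k) ℂ}
    (hψ : ψ.trace = 1) :
    P.output (iidServer A B) ψ U = idealOutput ψ (B * U * A) (P.acceptance A B) := by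
  have h := P.hasSum_average fun n ℓ =>
    acceptance_mem (P.test n ℓ) fun i => B * (P.test n ℓ).T i * A
  rw [idealOutput_eq]
  refine HasSum.tsum_eq ?_
  convert (h.smul_const (withAbort (conj (B * U * A).1 ψ) (-1))).add
    ((hasSum_toReal_pmf P.Ω).smul_const (withAbort (0 : Matrix (Qubits k) (Qubits k) ℂ) 1))
    using 1
  · funext n
    rw [mul_smul, ← smul_add]
    congr 1
    simp only [conditionalOutput_iidServer _ _ _ _ _ hψ, idealOutput_eq, smul_add, smul_smul,
      Finset.sum_add_distrib, ← Finset.sum_smul, sum_toReal_pmf, one_smul]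
  · rw [one_smul]; rfl

/-- `K` and `L` are functions of the delegated unitary so that attacks before it and after it are
both covered. -/
theorem Protocol.acceptance_le_add {k : ℕ} (P : Protocol k) (hN : P.expectedTests ≠ ⊤)
    {A B : Matrix.unitaryGroup (Qubits k) ℂ} 
    {K L : Matrix (Qubits k) (Qubits k) ℂ → Matrix (Qubits k) (Qubits k) ℂ}
    (hKL : ∀ (T : Matrix.unitaryGroup (Qubits k) ℂ) (z : ℂ), ‖z‖ = 1 →
      K T.1 + z • L T.1 ∈ Matrix.unitaryGroup (Qubits k) ℂ) {z : ℂ} (hz : ‖z‖ = 1)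
    (h₁ : ∀ T : Matrix.unitaryGroup (Qubits k) ℂ, K T.1 + (1 : ℂ) • L T.1 = T.1)
    (h₂ : ∀ T : Matrix.unitaryGroup (Qubits k) ℂ, K T.1 + z • L T.1 = (B * T * A).1) :
    P.acceptance 1 1 ≤ P.acceptance A B + P.expectedTests.toReal * (‖z - 1‖ / 2) := by
  refine P.average_le_add hN (fun n ℓ => acceptance_mem _ _) (fun n ℓ => acceptance_mem _ _)
    fun n ℓ => ?_
  have h := (abs_le.mp (acceptance_lipschitz (P.test n ℓ) (fun i => hKL ((P.test n ℓ).T i)) hz)).1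
  simp only [h₁, h₂] at h
  simp only [one_mul, mul_one]
  linarith

/-! ## Distinguishing the attacked output from the ideal outputs -/

theorem isEffect_of_isIdempotent {a : Type} [Fintype a] [DecidableEq a] {E : Matrix a a ℂ}
    (hE : E.IsHermitian) (h : E * E = E) : IsEffect E := by
  constructor
  · have := Matrix.posSemidef_conjTranspose_mul_self E
    rwa [hE, h] at this
  · have := Matrix.posSemidef_conjTranspose_mul_self (1 - E)
    rw [Matrix.conjTranspose_sub, Matrix.conjTranspose_one, hE] at this
    simpa [Matrix.mul_sub, Matrix.sub_mul, h] using this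

theorem isEffect_withAbort {k : ℕ} {E : Matrix (Qubits k) (Qubits k) ℂ} (hE : E.IsHermitian)
    (h : E * E = E) {c : ℝ} (hc : c * c = c) : IsEffect (withAbort E (c : ℂ)) := by
  have hc' : (c : ℂ) * c = c := by exact_mod_cast hc
  refine isEffect_of_isIdempotent ?_ ?_
  · rw [withAbort, Matrix.IsHermitian, Matrix.fromBlocks_conjTranspose, hE]
    simp only [Matrix.conjTranspose_zero]
    congr 1
    ext i j
    simp
  · rw [withAbort, Matrix.fromBlocks_multiply]
    simp only [h, Matrix.mul_zero, Matrix.zero_mul, add_zero, zero_add]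
    congr 1
    ext i j
    simp [Matrix.mul_apply, hc']

theorem isDensity_conj {k : ℕ} {ψ : Matrix (Qubits k) (Qubits k) ℂ} (hψ : IsDensity ψ)
    (U : Matrix.unitaryGroup (Qubits k) ℂ) : IsDensity (conj U.1 ψ) := by
  refine ⟨?_, (trace_conj U ψ).trans hψ.2⟩
  change (U.1 * ψ * U.1.conjTranspose).PosSemidef
  exact hψ.1.mul_mul_conjTranspose_same U.1

theorem trace_fromBlocks {a b : Type} [Fintype a] [Fintype b] (A : Matrix a a ℂ)
    (B : Matrix a b ℂ) (C : Matrix b a ℂ) (D : Matrix b b ℂ) :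
    (Matrix.fromBlocks A B C D).trace = A.trace + D.trace := by
  simp [Matrix.trace, Fintype.sum_sum_type]

theorem isHermitian_idealOutput {k : ℕ} {ψ : Matrix (Qubits k) (Qubits k) ℂ} (hψ : IsDensity ψ)
    (U : Matrix.unitaryGroup (Qubits k) ℂ) (p : ℝ) : (idealOutput ψ U p).IsHermitian := by
  have h : (conj U.1 ψ).IsHermitian := (isDensity_conj hψ U).1.1
  rw [idealOutput, withAbort, Matrix.IsHermitian, Matrix.fromBlocks_conjTranspose,
    Matrix.conjTranspose_smul, h]
  simp only [Matrix.conjTranspose_zero, Complex.star_def, Complex.conj_ofReal]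
  congr 1
  ext i j
  simp

theorem trace_withAbort_mul_idealOutput {k : ℕ} (E : Matrix (Qubits k) (Qubits k) ℂ) (c : ℝ)
    (ψ : Matrix (Qubits k) (Qubits k) ℂ) (U : Matrix.unitaryGroup (Qubits k) ℂ) (p : ℝ) :
    (withAbort E (c : ℂ) * idealOutput ψ U p).trace.re =
      p * (E * conj U.1 ψ).trace.re + c * (1 - p) := by
  rw [idealOutput, withAbort, withAbort, Matrix.fromBlocks_multiply, trace_fromBlocks,
    Matrix.zero_mul, add_zero, Matrix.mul_smul, Matrix.trace_smul]
  generalize (E * conj U.1 ψ).trace = x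
  simp [Matrix.trace, Matrix.mul_apply]

theorem trace_idealOutput {k : ℕ} {ψ : Matrix (Qubits k) (Qubits k) ℂ} (hψ : ψ.trace = 1)
    (U : Matrix.unitaryGroup (Qubits k) ℂ) (p : ℝ) : (idealOutput ψ U p).trace = 1 := by
  rw [idealOutput, withAbort, trace_fromBlocks, Matrix.trace_smul, trace_conj, hψ]
  simp [Matrix.trace]

/-- A test with a projector that accepts or rejects the abort symbol. -/
theorem sub_le_traceNorm_idealOutput {k : ℕ} {ψ E : Matrix (Qubits k) (Qubits k) ℂ}
    (hψ : IsDensity ψ) (hE : E.IsHermitian) (h : E * E = E) {c : ℝ} (hc : c * c = c)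
    (U V : Matrix.unitaryGroup (Qubits k) ℂ) (s p : ℝ) :
    (s * (E * conj U.1 ψ).trace.re + c * (1 - s))
      - (p * (E * conj V.1 ψ).trace.re + c * (1 - p)) ≤
      1 / 2 * traceNorm (idealOutput ψ U s - idealOutput ψ V p) := by
  rw [← trace_withAbort_mul_idealOutput, ← trace_withAbort_mul_idealOutput, ← Complex.sub_re,
    ← Matrix.trace_sub, ← Matrix.mul_sub]
  refine trace_mul_effect_le_traceNorm
    ((isHermitian_idealOutput hψ U s).sub (isHermitian_idealOutput hψ V p)) ?_
    (isEffect_withAbort hE h hc)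
  rw [Matrix.trace_sub, trace_idealOutput hψ.2, trace_idealOutput hψ.2, sub_self]

/-- The distinguishing test depends on `p`: if the ideal output aborts at least as often (`p ≤ s`),
the test rejects `⊥`; otherwise it accepts `⊥`. Either way the difference in abort weight does not
hurt. -/
theorem mul_sub_le_traceNorm_idealOutput {k : ℕ} {ψ E : Matrix (Qubits k) (Qubits k) ℂ}
    (hψ : IsDensity ψ) (hE : E.IsHermitian) (h : E * E = E)
    (U V : Matrix.unitaryGroup (Qubits k) ℂ) (s p : ℝ) :
    s * ((E * conj U.1 ψ).trace.re - (E * conj V.1 ψ).trace.re) ≤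
      1 / 2 * traceNorm (idealOutput ψ U s - idealOutput ψ V p) := by
  obtain ⟨h0, h1⟩ := trace_mul_density_re_mem (isEffect_of_isIdempotent hE h)
    (isDensity_conj hψ V)
  rcases le_total p s with hps | hps
  · refine le_trans ?_ (sub_le_traceNorm_idealOutput hψ hE h (c := 0) (by simp) U V s p)
    nlinarith
  · refine le_trans ?_ (sub_le_traceNorm_idealOutput hψ hE h (c := 1) (by simp) U V s p)
    nlinarith

/-! ## Phases on the last qubit -/

/-- The phase gate `diag (1, z)`. -/
def phase {z : ℂ} (hz : ‖z‖ = 1) : Matrix.unitaryGroup (Fin 2) ℂ :=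
  ⟨Matrix.diagonal ![1, z], by
    rw [Matrix.mem_unitaryGroup_iff, Matrix.star_eq_conjTranspose, Matrix.diagonal_conjTranspose,
      Matrix.diagonal_mul_diagonal, ← Matrix.diagonal_one]
    congr 1
    funext i
    fin_cases i <;> simp [Complex.mul_conj, Complex.normSq_eq_norm_sq, hz]⟩

/-- The projector on the states whose last qubit is `b`. -/
def lastQubitProj {k : ℕ} (hk : 0 < k) (b : Fin 2) : Matrix (Qubits k) (Qubits k) ℂ :=
  Matrix.diagonal fun x => if x ⟨k - 1, Nat.sub_lt hk Nat.one_pos⟩ = b then 1 else 0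

/-- This puts the attack in the form `K + z • L` that the degree-one estimate needs. -/
theorem onLastQubit_phase {k : ℕ} (hk : 0 < k) {z : ℂ} (hz : ‖z‖ = 1) :
    (onLastQubit hk (phase hz)).1 = lastQubitProj hk 0 + z • lastQubitProj hk 1 := by
  set l : Fin k := ⟨k - 1, Nat.sub_lt hk Nat.one_pos⟩ with hl
  ext x y
  simp only [onLastQubit, tensor, Matrix.of_apply, lastQubitProj, ← hl]
  by_cases hxy : x = y
  · subst hxy
    rw [Finset.prod_eq_single l (fun i _ hi => by simp [hi]) (by simp)]
    rcases Fin.exists_fin_two.mp ⟨x l, rfl⟩ with h | h <;> simp [phase, h]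
  · obtain ⟨i, hi⟩ := Function.ne_iff.mp hxy
    rw [Finset.prod_eq_zero (Finset.mem_univ i)]
    · simp [hxy]
    · split_ifs <;> simp [phase, hi]

theorem lastQubitProj_add {k : ℕ} (hk : 0 < k) :
    lastQubitProj hk 0 + (1 : ℂ) • lastQubitProj hk 1 = 1 := by
  rw [one_smul, lastQubitProj, lastQubitProj, Matrix.diagonal_add, ← Matrix.diagonal_one]
  congr 1
  funext x
  rcases Fin.exists_fin_two.mp ⟨x ⟨k - 1, Nat.sub_lt hk Nat.one_pos⟩, rfl⟩ with h | h <;>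
    simp [h]

/-- The rank one operator `v v† / 2`. -/
def halfProj {a : Type} (v : a → ℂ) : Matrix a a ℂ := (1 / 2 : ℂ) • Matrix.vecMulVec v (star v)

theorem isHermitian_halfProj {a : Type} (v : a → ℂ) : (halfProj v).IsHermitian := by
  ext i j
  simp [halfProj, Matrix.vecMulVec_apply, mul_comm]

theorem halfProj_mul_halfProj {a : Type} [Fintype a] (v w : a → ℂ) :
    halfProj v * halfProj w = (1 / 4 * (star v ⬝ᵥ w)) • Matrix.vecMulVec v (star w) := by
  rw [halfProj, halfProj, Matrix.smul_mul, Matrix.mul_smul, Matrix.vecMulVec_mul_vecMulVec,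
    smul_smul, Matrix.vecMulVec_smul, smul_smul]
  congr 1
  ring

theorem halfProj_idempotent {a : Type} [Fintype a] {v : a → ℂ} (hv : star v ⬝ᵥ v = 2) :
    halfProj v * halfProj v = halfProj v := by
  rw [halfProj_mul_halfProj, hv, halfProj]
  norm_num

theorem isDensity_halfProj {a : Type} [Fintype a] [DecidableEq a] {v : a → ℂ}
    (hv : star v ⬝ᵥ v = 2) : IsDensity (halfProj v) := by
  refine ⟨(isEffect_of_isIdempotent (isHermitian_halfProj v) (halfProj_idempotent hv)).1, ?_⟩
  rw [halfProj, Matrix.trace_smul, Matrix.trace_vecMulVec, dotProduct_comm, hv]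
  norm_num

theorem trace_halfProj_mul {a : Type} [Fintype a] (v w : a → ℂ) :
    (halfProj v * halfProj w).trace.re = 1 / 4 * Complex.normSq (star v ⬝ᵥ w) := by
  have h : v ⬝ᵥ star w = starRingEnd ℂ (star v ⬝ᵥ w) := by
    simp [dotProduct, mul_comm]
  rw [halfProj_mul_halfProj, Matrix.trace_smul, Matrix.trace_vecMulVec, h, smul_eq_mul, mul_assoc,
    Complex.mul_conj]
  simp

theorem conj_halfProj {a : Type} [Fintype a] (K : Matrix a a ℂ) (v : a → ℂ) :
    conj K (halfProj v) = halfProj (K.mulVec v) := by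
  simp only [conj, halfProj, LinearMap.coe_mk, AddHom.coe_mk, Matrix.mul_smul, Matrix.smul_mul,
    Matrix.mul_vecMulVec, Matrix.vecMulVec_mul, Matrix.star_mulVec]

/-- The vector `|0…00⟩ + z |0…01⟩`. -/
def lastQubitVec {k : ℕ} (hk : 0 < k) (z : ℂ) : Qubits k → ℂ :=
  Pi.single 0 1 + Pi.single (Pi.single ⟨k - 1, Nat.sub_lt hk Nat.one_pos⟩ 1) z

theorem star_lastQubitVec_dotProduct {k : ℕ} (hk : 0 < k) (w z : ℂ) :
    star (lastQubitVec hk w) ⬝ᵥ lastQubitVec hk z = 1 + starRingEnd ℂ w * z := by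
  have h : (Pi.single ⟨k - 1, Nat.sub_lt hk Nat.one_pos⟩ 1 : Qubits k) ≠ 0 := by simp
  simp [lastQubitVec, dotProduct_add, Pi.single_apply, h, h.symm, Pi.star_def]

theorem phase_mulVec_lastQubitVec {k : ℕ} (hk : 0 < k) (z : ℂ) :
    (lastQubitProj hk 0 + z • lastQubitProj hk 1).mulVec (lastQubitVec hk 1)
      = lastQubitVec hk z := by
  have h : (Pi.single ⟨k - 1, Nat.sub_lt hk Nat.one_pos⟩ 1 : Qubits k) ≠ 0 := by simp
  ext x
  simp only [lastQubitProj, Matrix.add_mulVec, Matrix.smul_mulVec, Matrix.mulVec_diagonal,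
    lastQubitVec, Pi.add_apply, Pi.smul_apply, Pi.single_apply, smul_eq_mul]
  by_cases h0 : x = 0
  · subst h0; simp [h.symm]
  by_cases h1 : x = Pi.single ⟨k - 1, Nat.sub_lt hk Nat.one_pos⟩ 1
  · subst h1; simp
  · simp [h0, h1]

/-- A chord of the unit circle starting at `1` can have any length up to the diameter; its other end
has real part `1 - t ^ 2 / 2`. -/
theorem exists_norm_sub_one_eq {t : ℝ} (h0 : 0 ≤ t) (h2 : t ≤ 2) :
    ∃ z : ℂ, ‖z‖ = 1 ∧ ‖z - 1‖ = t := by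
  have hs : Real.sqrt (1 - t ^ 2 / 4) ^ 2 = 1 - t ^ 2 / 4 := Real.sq_sqrt (by nlinarith)
  refine ⟨⟨1 - t ^ 2 / 2, t * Real.sqrt (1 - t ^ 2 / 4)⟩, ?_, ?_⟩
  · rw [← sq_eq_sq₀ (norm_nonneg _) zero_le_one, ← Complex.normSq_eq_norm_sq, Complex.normSq_apply]
    simp only
    linear_combination t ^ 2 * hs
  · rw [← sq_eq_sq₀ (norm_nonneg _) h0, ← Complex.normSq_eq_norm_sq, Complex.normSq_apply]
    simp only [Complex.sub_re, Complex.sub_im, Complex.one_re, Complex.one_im]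
    linear_combination t ^ 2 * hs

/-! ## The bound -/

theorem Protocol.IsCorrect.one_sub_acceptance_le {k : ℕ} (hk : 0 < k) {P : Protocol k} {ε : ℝ}
    (h : P.IsCorrect ε) : 1 - P.acceptance 1 1 ≤ ε := by
  have hψ := isDensity_halfProj (v := lastQubitVec hk 1)
    (by rw [star_lastQubitVec_dotProduct]; norm_num)
  have h' := h _ 1 hψ
  rw [honestServer, P.output_iidServer _ _ _ hψ.2] at h'
  -- With `E = 0` and `c = 1` the test is the projector onto `⊥`.
  refine le_trans ?_ ((sub_le_traceNorm_idealOutput hψ Matrix.isHermitian_zero (by simp) (c := 1)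
    (by simp) _ _ _ _).trans h')
  simp

theorem Protocol.IsSecure.acceptance_mul_le {k : ℕ} (hk : 0 < k) {P : Protocol k}
    {attacks : Set (Server k)} {ε : ℝ} (h : P.IsSecure attacks ε)
    {A B : Matrix.unitaryGroup (Qubits k) ℂ} (hmem : iidServer A B ∈ attacks) {z : ℂ}
    (hz' : ‖z‖ = 1) (hz : z ≠ 1) (hAB : (B * 1 * A).1 = lastQubitProj hk 0 + z • lastQubitProj hk 1) :
    P.acceptance A B * (‖z - 1‖ / 2) ≤ ε := by
  have hψ := isDensity_halfProj (v := lastQubitVec hk 1)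
    (by rw [star_lastQubitVec_dotProduct]; norm_num)
  refine (le_ciInf fun p => ?_).trans (h _ hmem _ 1 hψ)
  rw [P.output_iidServer _ _ _ hψ.2]
  have hn : ‖z - 1‖ ≠ 0 := by simpa [sub_eq_zero] using hz
  -- Projecting onto `|0…0⟩ + w |0…01⟩` gives probabilities that differ by `(conj w * (z - 1)).re /
  -- 2`; this phase maximizes the difference.
  set w : ℂ := (z - 1) / ‖z - 1‖ with hw
  have hw1 : ‖w‖ = 1 := by simp [hw, hn]
  have hη : star (lastQubitVec hk w) ⬝ᵥ lastQubitVec hk w = 2 := by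
    rw [star_lastQubitVec_dotProduct, mul_comm, Complex.mul_conj, Complex.normSq_eq_norm_sq, hw1]
    norm_num
  refine le_trans (le_of_eq ?_) (mul_sub_le_traceNorm_idealOutput hψ (isHermitian_halfProj _)
    (halfProj_idempotent hη) _ _ _ _)
  have hone : conj (1 : Matrix.unitaryGroup (Qubits k) ℂ).1 (halfProj (lastQubitVec hk 1)) =
      halfProj (lastQubitVec hk 1) := by
    rw [conj_halfProj]; simp
  have hre : (starRingEnd ℂ w * (z - 1)).re = ‖z - 1‖ := by
    have : starRingEnd ℂ w * (z - 1) = ‖z - 1‖ := by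
      rw [hw, map_div₀, Complex.conj_ofReal, div_mul_eq_mul_div, mul_comm, Complex.mul_conj,
        Complex.normSq_eq_norm_sq]
      have hn' : (‖z - 1‖ : ℂ) ≠ 0 := by exact_mod_cast hn
      push_cast
      field_simp
    rw [this, Complex.ofReal_re]
  have hadd : ∀ u : ℂ, ‖u‖ = 1 →
      Complex.normSq (1 + starRingEnd ℂ w * u) = 2 + 2 * (starRingEnd ℂ w * u).re := fun u hu => by
    rw [Complex.normSq_add, map_mul Complex.normSq, Complex.normSq_conj,
      Complex.normSq_eq_norm_sq w, Complex.normSq_eq_norm_sq u, hw1, hu, one_mul,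
      Complex.conj_re, map_one]
    ring
  rw [hone, hAB, conj_halfProj, phase_mulVec_lastQubitVec, trace_halfProj_mul, trace_halfProj_mul,
    star_lastQubitVec_dotProduct, star_lastQubitVec_dotProduct, hadd z hz', hadd 1 norm_one]
  rw [mul_sub, Complex.sub_re] at hre
  rw [← hre]
  ring

theorem Protocol.bound_of_mem {k : ℕ} (hk : 0 < k) {P : Protocol k} {attacks : Set (Server k)}
    (hN : 1 / 2 ≤ P.expectedTests.toReal) (hN' : P.expectedTests ≠ ⊤) {εH εD : ℝ}
    (hH : P.IsCorrect εH) (hD : P.IsSecure attacks εD)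
    (hattacks : HasLastQubitAccess hk attacks) :
    1 / (4 * P.expectedTests.toReal) ≤ εH + εD := by
  set N := P.expectedTests.toReal with hNdef
  have hN0 : 0 < N := by linarith
  -- This length limits the loss of acceptance to `1 / 2`; `N ≥ 1 / 2` keeps it within the diameter.
  obtain ⟨z, hz, hzt⟩ := exists_norm_sub_one_eq (t := 1 / N) (by positivity)
    (by rw [div_le_iff₀ hN0]; linarith)
  have hz1 : z ≠ 1 := by
    rintro rfl
    simp at hzt
    linarith
  set Q₀ := lastQubitProj hk 0
  set Q₁ := lastQubitProj hk 1
  have hQ : Q₀ + (1 : ℂ) • Q₁ = 1 := lastQubitProj_add hk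
  have hQz : ∀ (w : ℂ) (hw : ‖w‖ = 1), (onLastQubit hk (phase hw)).1 = Q₀ + w • Q₁ :=
    fun w hw => onLastQubit_phase hk hw
  have key : ∃ A B : Matrix.unitaryGroup (Qubits k) ℂ, iidServer A B ∈ attacks ∧
      (B * 1 * A).1 = Q₀ + z • Q₁ ∧
      P.acceptance 1 1 ≤ P.acceptance A B + N * (‖z - 1‖ / 2) := by
    rcases hattacks with h | h
    · refine ⟨_, _, h (phase hz), by rw [mul_one, one_mul]; exact hQz z hz,
        P.acceptance_le_add hN' (K := fun T => T * Q₀) (L := fun T => T * Q₁) (fun T w hw => ?_) hz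
          (fun T => ?_) (fun T => ?_)⟩ <;>
        rw [← Matrix.mul_smul, ← Matrix.mul_add]
      · rw [← hQz w hw]
        exact (T * onLastQubit hk (phase hw)).2
      · rw [hQ, Matrix.mul_one]
      · rw [← hQz z hz, one_mul]; rfl
    · refine ⟨_, _, h (phase hz), by rw [mul_one, mul_one]; exact hQz z hz,
        P.acceptance_le_add hN' (K := fun T => Q₀ * T) (L := fun T => Q₁ * T) (fun T w hw => ?_) hz
          (fun T => ?_) (fun T => ?_)⟩ <;>
        rw [← Matrix.smul_mul, ← Matrix.add_mul]
      · rw [← hQz w hw]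
        exact (onLastQubit hk (phase hw) * T).2
      · rw [hQ, Matrix.one_mul]
      · rw [← hQz z hz, mul_one]; rfl
  obtain ⟨A, B, hmem, hAB, hle⟩ := key
  have h₁ := hH.one_sub_acceptance_le hk
  have h₂ := hD.acceptance_mul_le hk hmem hz hz1 hAB
  have hP : P.acceptance 1 1 ≤ 1 := (P.average_mem fun n ℓ => acceptance_mem _ _).2
  rw [hzt] at h₂ hle
  have hNN : N * (1 / N / 2) = 1 / 2 := by field_simp
  rw [hNN] at hle
  have hc : 1 / N / 2 ≤ 1 := by rw [div_div, div_le_iff₀ (by positivity)]; linarith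
  have hc0 : 0 ≤ 1 / N / 2 := by positivity
  have h4 : 1 / (4 * N) = 1 / N / 2 * (1 / 2) := by field_simp; norm_num
  rw [h4]
  -- The products are `c` times the acceptance estimate and `(1 - c) (1 - a) ≥ 0`, with `c = 1 / N /
  -- 2` and `a` the honest acceptance.
  nlinarith [mul_nonneg hc0 (sub_nonneg.mpr hle), mul_nonneg (sub_nonneg.mpr hc) (sub_nonneg.mpr hP)]

end CutAndChoose

end

theorem mainTheorem4 (k : ℕ) (hk : 0 < k) (P : CutAndChoose.Protocol k)
    (attacks : Set (CutAndChoose.Server k))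
    (hattacks : CutAndChoose.HasLastQubitAccess hk attacks)
    (hN : 1 / 2 ≤ P.expectedTests) (εH εD : ℝ)
    (hH : P.IsCorrect εH) (hD : P.IsSecure attacks εD) :
    1 / (4 * P.expectedTests) ≤ ENNReal.ofReal (εH + εD) := by
  rcases eq_or_ne P.expectedTests ⊤ with h | h
  · simp [h, ENNReal.mul_top]
  have hN' : 1 / 2 ≤ P.expectedTests.toReal := by
    simpa using ENNReal.toReal_mono h hN
  have hb := CutAndChoose.Protocol.bound_of_mem hk hN' h hH hD hattacks
  have hfin : (1 / (4 * P.expectedTests)) ≠ ⊤ := by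
    refine ENNReal.div_ne_top ENNReal.one_ne_top (mul_ne_zero (by norm_num) ?_)
    rintro h0
    simp [h0] at hN
  rw [← ENNReal.ofReal_toReal hfin]
  refine ENNReal.ofReal_le_ofReal ?_
  simpa using hb
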